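/- Let $R$ be a commutative ring and let $\mathcal{C}$ be an $R$-linear abelian category which is locally finitely presentable, i.e. (locally small,) cocomplete and with a set of finitely presentable objects forming a strong generator; here $X$ is finitely presentable if $\mathcal{C}(X,-)$ preserves filtered colimits. Let $\mathcal{A}\subseteq\mathcal{C}$ be a full subcategory whose objects are finitely presentable in $\mathcal{C}$, which is a generator of $\mathcal{C}$ (the functors $\mathcal{C}(A,-)$, $A\in\mathcal{A}$, are jointly faithful), and which is closed under finite direct sums (including the empty one). Let $K\colon\mathcal{A}\to\mathcal{C}$ be the inclusion. Let $\mathcal{P}\mathcal{A}$ be the category of $R$-linear functors $\mathcal{A}^{\mathrm{op}}\to\mathrm{Mod}_R$ and $Y\colon\mathcal{A}\to\mathcal{P}\mathcal{A}$ the Yoneda embedding. Let $\Sigma$ be the set of sequences $A_0\to A_1\to A_2\to 0$ in $\mathcal{A}$ which are right exact in $\mathcal{C}$, and let $\mathrm{Lex}_\Sigma[\mathcal{A}^{\mathrm{op}},\mathrm{Mod}_R]$ be the full subcategory of $\mathcal{P}\mathcal{A}$ of those $F$ for which $0\to F(A_2)\to F(A_1)\to F(A_0)$ is exact for every sequence in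 $\Sigma$. For $X\in\mathcal{C}$ the presheaf $\mathcal{C}(K-,X)$ lies in $\mathrm{Lex}_\Sigma$; write $$\mathrm{Hom}_{\mathcal{A}}(K,-)\colon\mathcal{C}\to\mathrm{Lex}_\Sigma[\mathcal{A}^{\mathrm{op}},\mathrm{Mod}_R],\qquad X\mapsto\mathcal{C}(K-,X).$$ Then the $R$-linear left Kan extension $\mathrm{Lan}_Y K\colon\mathcal{P}\mathcal{A}\to\mathcal{C}$ exists (that is, an $R$-linear functor with a natural transformation $\alpha\colon K\to(\mathrm{Lan}_Y K)\circ Y$ such that $\beta\mapsto(\beta Y)\circ\alpha$ is a bijection $\mathrm{Nat}(\mathrm{Lan}_Y K,G)\cong\mathrm{Nat}(K,G\circ Y)$ for every $R$-linear $G\colon\mathcal{P}\mathcal{A}\to\mathcal{C}$), and $\mathrm{Hom}_{\mathcal{A}}(K,-)$ and the restriction $\mathrm{Lan}_Y K|_{\mathrm{Lex}_\Sigma}\colon\mathrm{Lex}_\Sigma[\mathcal{A}^{\mathrm{op}},\mathrm{Mod}_R]\to\mathcal{C}$ are mutually inverse equivalences of categories. -/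

import Mathlib

open CategoryTheory Limits Opposite

universe w v u v₁ v₂ v₃ u₁ u₂ u₃

namespace LinearLex

noncomputable section

section Presheaves

variable (R : Type w) [CommRing R] (A : Type u) [Category.{v} A] [Preadditive A] [Linear R A]

/-- The property that a presheaf of `R`-modules on an `R`-linear category is an `R`-linear
functor. -/
def IsLinearPresheaf : ObjectProperty (Aᵒᵖ ⥤ ModuleCat.{v} R) :=
  fun F => F.Additive ∧ ∀ ⦃X Y : A⦄ (r : R) (f : X ⟶ Y), F.map (r • f).op = r • F.map f.op

/-- The category of `R`-linear presheaves on an `R`-linear category. -/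
abbrev LinearPresheaf := (IsLinearPresheaf R A).FullSubcategory

/-- The Yoneda embedding of an `R`-linear category into its category of `R`-linear presheaves. -/
def linYoneda : A ⥤ LinearPresheaf R A :=
  (IsLinearPresheaf R A).lift (linearYoneda R A) fun X =>
    ⟨⟨by intro _ _ f g; ext a; exact Preadditive.add_comp _ _ _ f.unop g.unop a⟩,
     by intro _ _ r f; ext a; exact Linear.smul_comp _ _ _ r f a⟩

variable {A}

/-- Given a set `T` of sequences `A₀ ⟶ A₁ ⟶ A₂` in `A` (standing for `A₀ ⟶ A₁ ⟶ A₂ ⟶ 0`), the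
property that an `R`-linear presheaf `F` turns each of them into an exact sequence
`0 ⟶ F A₂ ⟶ F A₁ ⟶ F A₀` of `R`-modules, that is, into a kernel diagram. -/
def IsLex (T : Set (ShortComplex A)) : ObjectProperty (LinearPresheaf R A) :=
  fun F => ∀ S ∈ T, Function.Injective (F.obj.map S.g.op) ∧
    Function.Exact (F.obj.map S.g.op) (F.obj.map S.f.op)

/-- The category `Lex_T[Aᵒᵖ, Mod_R]`, a full subcategory of the `R`-linear presheaves. -/
abbrev Lex (T : Set (ShortComplex A)) := (IsLex R T).FullSubcategory

end Presheaves

section KanExtension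

variable (R : Type w) [CommRing R]
  {A : Type u₁} [Category.{v₁} A] [Preadditive A] [Linear R A]
  {B : Type u₂} [Category.{v₂} B] [Preadditive B] [Linear R B]
  {D : Type u₃} [Category.{v₃} D] [Preadditive D] [Linear R D]

/-- The `R`-linear functor `L : B ⥤ D`, together with `α : F ⟶ J ⋙ L`, is the left Kan extension
of `F : A ⥤ D` along `J : A ⥤ B` in the `R`-linear sense: composition with `α` gives a bijection
`Nat(L, G) ≅ Nat(F, J ⋙ G)` for every `R`-linear functor `G : B ⥤ D`. -/
structure IsLinearLeftKanExtension (J : A ⥤ B) (F : A ⥤ D) (L : B ⥤ D) (α : F ⟶ J ⋙ L) :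
    Prop where
  additive : L.Additive
  linear : L.Linear R
  bijective : ∀ G : B ⥤ D, G.Additive → G.Linear R →
    Function.Bijective (fun β : L ⟶ G => α ≫ J.whiskerLeft β)

end KanExtension

section Subcategory

variable {C : Type u} [Category.{v} C] [Abelian C]

/-- The set of sequences `A₀ ⟶ A₁ ⟶ A₂ ⟶ 0` in the full subcategory of `C` given by `P` which
are right exact in `C`. -/
def rightExactSequences (P : ObjectProperty C) : Set (ShortComplex P.FullSubcategory) :=
  {S | (S.map P.ι).Exact ∧ Epi (S.map P.ι).g}

variable (R : Type w) [CommRing R] [Linear R C] (P : ObjectProperty C)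

/-- The functor sending `X : C` to the `R`-linear presheaf `C(K-, X)` on the full subcategory
given by `P`, where `K` is the inclusion. -/
def homPresheaf : C ⥤ LinearPresheaf R P.FullSubcategory :=
  (IsLinearPresheaf R P.FullSubcategory).lift
    (linearYoneda R C ⋙ (Functor.whiskeringLeft _ _ _).obj P.ι.op) fun X =>
    ⟨⟨by intro _ _ f g; ext a; exact Preadditive.add_comp _ _ _ f.unop.hom g.unop.hom a⟩,
     by intro _ _ r f; ext a; exact Linear.smul_comp _ _ _ r f.hom a⟩

lemma isLex_homPresheaf (X : C) :
    IsLex R (rightExactSequences P) ((homPresheaf R P).obj X) := by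
  rintro S ⟨hS, hg⟩
  refine ⟨?_, ?_⟩
  · intro (a : S.X₃.obj ⟶ X) (b : S.X₃.obj ⟶ X) hab
    exact (cancel_epi (S.map P.ι).g).1 hab
  · intro (a : S.X₂.obj ⟶ X)
    constructor
    · intro (ha : (S.map P.ι).f ≫ a = 0)
      exact ⟨hS.desc a ha, hS.g_desc a ha⟩
    · rintro ⟨b, rfl⟩
      exact ((S.map P.ι).zero_assoc b).trans zero_comp

/-- The functor `Hom_A(K, -) : C ⥤ Lex_Σ[Aᵒᵖ, Mod_R]`, where `K : A ⥤ C` is the inclusion of the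
full subcategory given by `P` and `Σ` is the set of sequences in it that are right exact in
`C`. -/
def homLex : C ⥤ Lex R (rightExactSequences P) :=
  (IsLex R (rightExactSequences P)).lift (homPresheaf R P) (isLex_homPresheaf R P)

instance : (homLex R P).Additive where
  map_add {X Y f g} := by
    apply ObjectProperty.hom_ext
    apply ObjectProperty.hom_ext
    ext Z (a : Z.unop.obj ⟶ X)
    exact Preadditive.comp_add _ _ _ a f g

instance : (homLex R P).Linear R where
  map_smul {X Y} f r := by
    apply ObjectProperty.hom_ext
    apply ObjectProperty.hom_ext
    ext Z (a : Z.unop.obj ⟶ X)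
    exact Linear.comp_smul _ _ _ a r f

end Subcategory

end

end LinearLex

/-! The functor X ↦ C(K-, X) from C to all linear presheaves (`homPresheaf`) is fully faithful and
has a left adjoint L. Such an L is automatically a linear left Kan extension of K along Yoneda
(`isLinearLeftKanExtension_yonedaUnit`), and these are unique up to isomorphism. The counit is
invertible by full faithfulness, so what remains is that the unit is invertible at presheaves in
Lex_Σ (`isIso_unit`).

The adjoint comes from presentations. As objects of P are finitely presentable, C(K-, ∐ Aᵢ) is the
coproduct of the representables (`exists_hom_coproduct`). Hence every presheaf F is the cokernel of
some C(K-, B) ⟶ C(K-, G) with B and G coproducts of objects of P, and L F is the cokernel of B ⟶ G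
taken in C. Full faithfulness gives its universal property (`bijective_unit_comp`).

For F in Lex_Σ, a morphism from A in P to L F lifts to G only after an epimorphism E ⟶ A, and the
resulting section of F must be descended to A. The cover can be refined by an object of P
(`exists_epi_of_epi`), and the refined epimorphism ends a sequence in Σ (`exists_right_exact`). Both
facts rest on `exists_exact_of_exact`: a finitely presentable cokernel of a finitely presentable
object needs only finitely many relations. -/

namespace LinearLex

noncomputable section

/-! ### Finitely presentable objects in a cocomplete abelian category -/

section FinitelyPresentable

variable {C : Type u} [Category.{v} C]

/-- A small family of objects of `P` representing all of them up to isomorphism. -/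
structure SmallModel (P : ObjectProperty C) where
  /-- the index type -/
  J : Type v
  /-- the family of objects -/
  obj : J → C
  prop (j : J) : P (obj j)
  exists_iso {X : C} (hX : P X) : ∃ j, Nonempty (X ≅ obj j)

/-- The available coproducts are indexed by types in `v`, so covers have to be formed from a small
set of representatives of `P`. -/
lemma nonempty_smallModel (P : ObjectProperty C) [ObjectProperty.EssentiallySmall.{v} P] :
    Nonempty (SmallModel P) := by
  obtain ⟨Q, _, hQ₁, hQ₂⟩ := ObjectProperty.EssentiallySmall.exists_small_le.{v} P
  refine ⟨⟨Shrink.{v} (Subtype Q), fun j => ((equivShrink _).symm j).1,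
    fun j => hQ₁ _ ((equivShrink _).symm j).2, fun {X} hX => ?_⟩⟩
  obtain ⟨Y, hY, ⟨e⟩⟩ := hQ₂ X hX
  exact ⟨equivShrink _ ⟨Y, hY⟩, ⟨e ≪≫ eqToIso (by simp)⟩⟩

variable [HasColimitsOfSize.{v, v} C]

variable {P : ObjectProperty C}

/-- Every object is a quotient of the coproduct of all objects in a small model of `P` over it. -/
lemma SmallModel.epi_desc (M : SmallModel P) (hP : P.IsSeparating) (X : C) :
    Epi (Sigma.desc (fun i : Σ j, (M.obj j ⟶ X) => i.2)) := by
  refine ⟨fun {Z} a b hab => hP _ _ fun G hG h => ?_⟩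
  obtain ⟨j, ⟨e⟩⟩ := M.exists_iso hG
  have := Sigma.ι (fun i : Σ j, (M.obj j ⟶ X) => M.obj i.1) ⟨j, e.inv ≫ h⟩ ≫= hab
  simpa using this

variable [Abelian C]

/-- A morphism from a finitely presentable object to a coproduct is a finite sum of morphisms
through the summands. -/
lemma exists_eq_sum_ι {I : Type v} (f : I → C) {X : C} [IsFinitelyPresentable.{v} X]
    (g : X ⟶ ∐ f) :
    ∃ (s : Finset I) (t : ∀ i, X ⟶ f i), g = ∑ i ∈ s, t i ≫ Sigma.ι f i := by
  classical
  -- The coproduct is the filtered colimit of its finite subcoproducts, so `g` factors through one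
  -- of them, where it splits into coordinates.
  obtain ⟨S, p, hp⟩ := IsFinitelyPresentable.exists_hom_of_isColimit
    (CoproductsFromFiniteFiltered.isColimitFiniteSubproductsCocone f) g
  let F : S → C := fun x => f x.1.as
  let p' : X ⟶ ∐ F := p
  have hp' : p' ≫ Sigma.desc (fun x : S => Sigma.ι f x.1.as) = g := hp
  have hid : 𝟙 (∐ F) = ∑ x : S, Sigma.π F x ≫ Sigma.ι F x := by
    refine Sigma.hom_ext _ _ fun y => ?_
    rw [Preadditive.comp_sum, Finset.sum_eq_single y]
    · simp
    · intro x _ hx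
      rw [Sigma.ι_π_of_ne_assoc _ hx.symm, zero_comp]
    · simp
  refine ⟨S.image Discrete.as, fun i => if h : (Discrete.mk i) ∈ S then
    p' ≫ Sigma.π F ⟨_, h⟩ else 0, ?_⟩
  rw [Finset.sum_image (by rintro ⟨x⟩ _ ⟨y⟩ _ rfl; rfl), ← Finset.sum_coe_sort, ← hp',
    ← Category.id_comp (Sigma.desc _), hid, Preadditive.sum_comp, Preadditive.comp_sum]
  refine Finset.sum_congr rfl fun x _ => ?_
  obtain ⟨⟨x⟩, hx⟩ := x
  simp [hx, F]

/-! ### Cokernels of families as filtered colimits of finite quotients -/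

section FiniteQuotients

variable {I : Type v} {f : I → C} {X : C} (d : ∀ i, f i ⟶ X)

/-- The quotients of `X` by the images of finitely many of the morphisms `d i`. -/
def finiteQuotients : Finset I ⥤ C where
  obj S := cokernel (Limits.Sigma.desc fun i : S => d i)
  map {S T} h := cokernel.desc _ (cokernel.π _) (by
    refine Sigma.hom_ext _ _ fun i => ?_
    rw [Sigma.ι_desc_assoc, comp_zero,
      ← Sigma.ι_desc (fun i : T => d i) ⟨i.1, leOfHom h i.2⟩, Category.assoc,
      cokernel.condition, comp_zero])

/-- The projection to a finite quotient. -/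
def finiteQuotientsπ (S : Finset I) : X ⟶ (finiteQuotients d).obj S :=
  cokernel.π (Limits.Sigma.desc fun i : S => d i)

instance (S : Finset I) : Epi (finiteQuotientsπ d S) :=
  inferInstanceAs (Epi (cokernel.π (Limits.Sigma.desc fun i : S => d i)))

lemma comp_finiteQuotientsπ {S : Finset I} {i : I} (hi : i ∈ S) :
    d i ≫ finiteQuotientsπ d S = 0 := by
  have h := Sigma.ι (fun i : S => f i) ⟨i, hi⟩ ≫=
    cokernel.condition (Limits.Sigma.desc fun i : S => d i)
  rwa [Sigma.ι_desc_assoc, comp_zero] at h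

lemma finiteQuotientsπ_map {S T : Finset I} (h : S ⟶ T) :
    finiteQuotientsπ d S ≫ (finiteQuotients d).map h = finiteQuotientsπ d T :=
  cokernel.π_desc _ _ _

lemma finiteQuotientsπ_map_assoc {S T : Finset I} (h : S ⟶ T) {Z : C}
    (k : (finiteQuotients d).obj T ⟶ Z) :
    finiteQuotientsπ d S ≫ (finiteQuotients d).map h ≫ k = finiteQuotientsπ d T ≫ k := by
  rw [← Category.assoc, finiteQuotientsπ_map]

lemma exists_finiteQuotientsπ_comp_eq (S : Finset I) {Z : C} (q : X ⟶ Z)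
    (hq : ∀ i ∈ S, d i ≫ q = 0) : ∃ r, finiteQuotientsπ d S ≫ r = q :=
  ⟨cokernel.desc _ q (Sigma.hom_ext _ _ fun i => by
    rw [Sigma.ι_desc_assoc, hq _ i.2, comp_zero]), cokernel.π_desc _ _ _⟩

variable {Q : C} {p : X ⟶ Q} (h : ∀ i, d i ≫ p = 0)

/-- A morphism annihilating all `d i` factors through all finite quotients. -/
def finiteQuotientsCocone : Cocone (finiteQuotients d) where
  pt := Q
  ι :=
    { app := fun S => (exists_finiteQuotientsπ_comp_eq d S p fun i _ => h i).choose
      naturality := fun S T a => by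
        rw [← cancel_epi (finiteQuotientsπ d S), finiteQuotientsπ_map_assoc,
          (exists_finiteQuotientsπ_comp_eq d T p fun i _ => h i).choose_spec]
        dsimp
        rw [Category.comp_id,
          (exists_finiteQuotientsπ_comp_eq d S p fun i _ => h i).choose_spec] }

lemma finiteQuotientsπ_cocone (S : Finset I) :
    finiteQuotientsπ d S ≫ (finiteQuotientsCocone d h).ι.app S = p :=
  (exists_finiteQuotientsπ_comp_eq d S p fun i _ => h i).choose_spec

lemma finiteQuotientsπ_cocone_assoc (S : Finset I) {Z : C} (k : Q ⟶ Z) :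
    finiteQuotientsπ d S ≫ (finiteQuotientsCocone d h).ι.app S ≫ k = p ≫ k :=
  (Category.assoc _ _ _).symm.trans (congrArg (· ≫ k) (finiteQuotientsπ_cocone d h S))

/-- The cokernel of a family of morphisms is the filtered colimit of the finite quotients. -/
def isColimitFiniteQuotientsCocone [Epi p]
    (hp : ∀ ⦃T : C⦄ (q : X ⟶ T), (∀ i, d i ≫ q = 0) → ∃ r : Q ⟶ T, p ≫ r = q) :
    IsColimit (finiteQuotientsCocone d h) := by
  classical
  -- A cocone is determined by its component at `∅`, where nothing has been divided out; the
  -- component at `{i}` then shows that `d i` is killed.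
  have key (s : Cocone (finiteQuotients d)) (S : Finset I) :
      finiteQuotientsπ d S ≫ s.ι.app S = finiteQuotientsπ d ∅ ≫ s.ι.app ∅ := by
    rw [← s.w (homOfLE (Finset.empty_subset S) : (∅ : Finset I) ⟶ S),
      finiteQuotientsπ_map_assoc]
  have hs (s : Cocone (finiteQuotients d)) :
      ∃ r : Q ⟶ s.pt, p ≫ r = finiteQuotientsπ d ∅ ≫ s.ι.app ∅ := by
    refine hp _ fun i => ?_
    rw [← key s {i}, ← Category.assoc, comp_finiteQuotientsπ d (by simp)]
    exact zero_comp
  choose r hr using hs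
  exact
    { desc := r
      fac := fun s S => by
        rw [← cancel_epi (finiteQuotientsπ d S), key s S, ← hr]
        exact finiteQuotientsπ_cocone_assoc d h S _
      uniq := fun s m hm => by
        refine (cancel_epi p).1 ?_
        rw [hr, ← hm]
        exact (finiteQuotientsπ_cocone_assoc d h ∅ m).symm }

end FiniteQuotients

/-- If `E ⟶ X ⟶ Q ⟶ 0` is right exact with `X` and `Q` finitely presentable, then `E` may be
replaced by an object of a generator closed under finite sums. -/
lemma exists_exact_of_exact (M : SmallModel P) (hP : P.IsSeparating)
    (hsum : ∀ (n : ℕ) (X : Fin n → C), (∀ i, P (X i)) →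
      ∃ b : Bicone X, Nonempty b.IsBilimit ∧ P b.pt)
    {E X Q : C} [IsFinitelyPresentable.{v} X] [IsFinitelyPresentable.{v} Q]
    (e : E ⟶ X) (p : X ⟶ Q) [Epi p] (w : e ≫ p = 0) (he : (ShortComplex.mk e p w).Exact) :
    ∃ (D : C) (_ : P D) (d : D ⟶ E) (w' : (d ≫ e) ≫ p = 0),
      (ShortComplex.mk (d ≫ e) p w').Exact := by
  classical
  let I := Σ j, (M.obj j ⟶ E)
  let d (i : I) : M.obj i.1 ⟶ X := i.2 ≫ e
  have hd (i : I) : d i ≫ p = 0 := by simp [d, w]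
  have := M.epi_desc hP E
  have hc := isColimitFiniteQuotientsCocone d hd (fun T q hq => by
    refine ⟨he.desc q ?_, he.g_desc q _⟩
    rw [← cancel_epi (Limits.Sigma.desc (fun i : I => i.2)), comp_zero]
    exact Sigma.hom_ext _ _ fun i => by simpa [d] using hq i)
  -- `Q` is finitely presentable, so its identity lifts to some finite quotient.
  obtain ⟨S, s, hs⟩ := IsFinitelyPresentable.exists_hom_of_isColimit hc (𝟙 Q)
  -- `p ≫ s` and the projection of `X` agree in the colimit `Q`; as `X` is finitely presentable they
  -- already agree at a stage `T`. Thus the projection to that stage factors through `p`, so the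
  -- relations in `T` suffice.
  obtain ⟨T, a, b, hab⟩ := IsFinitelyPresentable.exists_eq_of_isColimit hc
    (p ≫ s) (finiteQuotientsπ d S) (by
      rw [Category.assoc, hs, finiteQuotientsπ_cocone]
      exact Category.comp_id _)
  rw [finiteQuotientsπ_map] at hab
  obtain ⟨B, ⟨hB⟩, hPB⟩ := hsum (Fintype.card T)
    (fun k => M.obj ((Fintype.equivFin T).symm k).1.1)
    fun k => M.prop _
  let dB : B.pt ⟶ E := hB.isColimit.desc
    (Cofan.mk E fun k => ((Fintype.equivFin T).symm k).1.2)
  have hdB (k) : B.ι k ≫ dB = ((Fintype.equivFin T).symm k).1.2 :=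
    hB.isColimit.fac _ ⟨k⟩
  have hk {Z : C} (q : X ⟶ Z) (hq : (dB ≫ e) ≫ q = 0) (i) (hi : i ∈ T) : d i ≫ q = 0 := by
    obtain ⟨k, hk⟩ := (Fintype.equivFin T).symm.surjective ⟨i, hi⟩
    have h : d ((Fintype.equivFin T).symm k).1 ≫ q = 0 := by
      dsimp only [d]
      rw [← hdB, Category.assoc, Category.assoc, ← Category.assoc dB, hq, comp_zero]
    rwa [hk] at h
  refine ⟨B.pt, hPB, dB, by rw [Category.assoc, w, comp_zero], ?_⟩
  refine ShortComplex.exact_of_g_is_cokernel _ (CokernelCofork.IsColimit.ofπ' _ _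
    fun {Z} q hq => ?_)
  exact ⟨s ≫ (finiteQuotients d).map a ≫
    (exists_finiteQuotientsπ_comp_eq d T q (hk q hq)).choose, by
      dsimp only
      rw [← Category.assoc, ← Category.assoc, hab]
      exact (exists_finiteQuotientsπ_comp_eq d T q (hk q hq)).choose_spec⟩

/-- An epimorphism onto a finitely presentable object remains epic after restriction along a
morphism from an object of a generator closed under finite sums. -/
lemma exists_epi_of_epi (M : SmallModel P) (hP : P.IsSeparating)
    (hsum : ∀ (n : ℕ) (X : Fin n → C), (∀ i, P (X i)) →
      ∃ b : Bicone X, Nonempty b.IsBilimit ∧ P b.pt)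
    (hfp : ∀ X : C, P X → IsFinitelyPresentable.{v} X)
    {E X : C} (hX : P X) (e : E ⟶ X) [Epi e] :
    ∃ (D : C) (_ : P D) (d : D ⟶ E), Epi (d ≫ e) := by
  -- The empty sum supplies a finitely presentable zero object, so that `e` can be treated as a
  -- right exact sequence ending in it.
  obtain ⟨B, ⟨hB⟩, hPB⟩ := hsum 0 (fun k => k.elim0) fun k => k.elim0
  have hBz : IsZero B.pt := by
    rw [IsZero.iff_id_eq_zero]
    exact hB.isLimit.hom_ext fun ⟨k⟩ => k.elim0
  have := hfp _ hX
  have := hfp _ hPB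
  have : Epi (0 : X ⟶ B.pt) := hBz.epi _
  obtain ⟨D, hD, d, _, h⟩ := exists_exact_of_exact M hP hsum e (0 : X ⟶ B.pt) comp_zero
    ((ShortComplex.exact_iff_epi _ rfl).2 ‹_›)
  exact ⟨D, hD, d, (ShortComplex.exact_iff_epi _ rfl).1 h⟩

end FinitelyPresentable

/-! ### Sections of linear presheaves and the Yoneda lemma -/

section Sections

variable {R : Type w} [CommRing R] {A : Type u} [Category.{v} A] [Preadditive A] [Linear R A]
  (F : LinearPresheaf R A) {G H : LinearPresheaf R A} {X Y Z : A}

/-- The module of sections of a linear presheaf over an object. -/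
abbrev sec (X : A) : ModuleCat.{v} R := F.obj.obj (op X)

/-- Restriction of sections along a morphism. -/
def res (f : X ⟶ Y) : sec F Y →ₗ[R] sec F X := (F.obj.map f.op).hom

@[simp]
lemma res_id (x : sec F X) : res F (𝟙 X) x = x := by
  simp [res]

@[simp]
lemma res_comp (f : X ⟶ Y) (g : Y ⟶ Z) (x : sec F Z) :
    res F (f ≫ g) x = res F f (res F g x) := by
  simp [res]

lemma res_add (f g : X ⟶ Y) (x : sec F Y) : res F (f + g) x = res F f x + res F g x := by
  have := F.property.1
  simp [res, op_add]

@[simp]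
lemma res_zero (x : sec F Y) : res F (0 : X ⟶ Y) x = 0 := by
  have := F.property.1
  simp [res]

lemma res_smul (r : R) (f : X ⟶ Y) (x : sec F Y) : res F (r • f) x = r • res F f x := by
  simp [res, F.property.2]

variable {F}

/-- The value of a morphism of linear presheaves on sections over an object. -/
def evalAt (φ : F ⟶ G) (X : A) : sec F X →ₗ[R] sec G X := (φ.hom.app (op X)).hom

lemma evalAt_res (φ : F ⟶ G) (f : X ⟶ Y) (x : sec F Y) :
    evalAt φ X (res F f x) = res G f (evalAt φ Y x) :=
  ConcreteCategory.congr_hom (φ.hom.naturality f.op) x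

@[simp]
lemma evalAt_id (x : sec F X) : evalAt (𝟙 F) X x = x := rfl

@[simp]
lemma evalAt_comp (φ : F ⟶ G) (ψ : G ⟶ H) (x : sec F X) :
    evalAt (φ ≫ ψ) X x = evalAt ψ X (evalAt φ X x) := rfl

lemma hom_ext_evalAt {φ ψ : F ⟶ G} (h : ∀ X x, evalAt φ X x = evalAt ψ X x) : φ = ψ := by
  apply ObjectProperty.hom_ext
  ext X x
  exact h X.unop x

/-- A morphism of linear presheaves from its values on sections. -/
def mkHom (φ : ∀ X, sec F X →ₗ[R] sec G X)
    (hφ : ∀ ⦃X Y : A⦄ (f : X ⟶ Y) (x : sec F Y), φ X (res F f x) = res G f (φ Y x)) : F ⟶ G :=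
  ObjectProperty.homMk
    { app := fun X => ModuleCat.ofHom (φ X.unop)
      naturality := fun X Y f => by
        ext x
        exact hφ f.unop x }

/-- The isomorphism criterion on sections. -/
lemma isIso_of_bijective_evalAt (φ : F ⟶ G) (h : ∀ X, Function.Bijective (evalAt φ X)) :
    IsIso φ := by
  let e X := LinearEquiv.ofBijective (evalAt φ X) (h X)
  refine ⟨mkHom (fun X => (e X).symm.toLinearMap) (fun X Y f x => ?_), ?_, ?_⟩
  · apply (e X).injective
    obtain ⟨y, rfl⟩ := (e Y).surjective x
    have := evalAt_res φ f y
    simp only [LinearEquiv.coe_coe, LinearEquiv.apply_symm_apply, LinearEquiv.symm_apply_apply]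
    exact this.symm
  · exact hom_ext_evalAt fun X x => (e X).symm_apply_apply x
  · exact hom_ext_evalAt fun X x => (e X).apply_symm_apply x

/-- The Yoneda lemma: the morphism from a representable presheaf given by a section. -/
def yonedaMap (x : sec F X) : (linYoneda R A).obj X ⟶ F :=
  mkHom (fun Y => { toFun := fun (f : Y ⟶ X) => res F f x
                    map_add' := fun f g => res_add F f g x
                    map_smul' := fun r f => res_smul F r f x }) fun _ _ f g => res_comp F f g x

/-- A morphism as a section of a representable presheaf. -/
def yonedaSec (f : Y ⟶ X) : sec ((linYoneda R A).obj X) Y := f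

lemma evalAt_yonedaMap (x : sec F X) (f : Y ⟶ X) :
    evalAt (yonedaMap x) Y (yonedaSec f) = res F f x := rfl

lemma res_yonedaSec (g : Z ⟶ Y) (f : Y ⟶ X) :
    res ((linYoneda R A).obj X) g (yonedaSec f) = yonedaSec (g ≫ f) := rfl

lemma evalAt_linYoneda_map (g : X ⟶ Y) (f : Z ⟶ X) :
    evalAt ((linYoneda R A).map g) Z (yonedaSec f) = yonedaSec (f ≫ g) := rfl

lemma yoneda_hom_ext {φ ψ : (linYoneda R A).obj X ⟶ F}
    (h : evalAt φ X (yonedaSec (𝟙 X)) = evalAt ψ X (yonedaSec (𝟙 X))) : φ = ψ := by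
  refine hom_ext_evalAt fun Y (f : Y ⟶ X) => ?_
  have hf : f = res ((linYoneda R A).obj X) f (yonedaSec (𝟙 X)) :=
    (Category.comp_id f).symm
  rw [hf, evalAt_res, evalAt_res, h]

lemma yonedaMap_comp (x : sec F X) (φ : F ⟶ G) : yonedaMap x ≫ φ = yonedaMap (evalAt φ X x) :=
  yoneda_hom_ext (by simp [evalAt_yonedaMap])

lemma linYoneda_map_comp_yonedaMap (f : Y ⟶ X) (x : sec F X) :
    (linYoneda R A).map f ≫ yonedaMap x = yonedaMap (res F f x) :=
  yoneda_hom_ext (by simp [evalAt_yonedaMap, evalAt_linYoneda_map])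

lemma yonedaMap_add (x y : sec F X) : yonedaMap (x + y) = yonedaMap x + yonedaMap y :=
  yoneda_hom_ext (by
    change _ = evalAt (yonedaMap x) X _ + evalAt (yonedaMap y) X _
    simp [evalAt_yonedaMap])

lemma yonedaMap_smul (r : R) (x : sec F X) : yonedaMap (r • x) = r • yonedaMap x :=
  yoneda_hom_ext (by
    change _ = r • evalAt (yonedaMap x) X _
    simp [evalAt_yonedaMap])

end Sections

/-! ### Sections of the presheaves C(K-, X) -/

section HomPresheaf

variable (R : Type w) [CommRing R] {C : Type u} [Category.{v} C] [Abelian C] [Linear R C]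
  {P : ObjectProperty C}

/-- The sections of `C(K-, X)` are the morphisms to `X`. -/
def secHom {X : C} {A : P.FullSubcategory} : (A.obj ⟶ X) ≃ₗ[R] sec ((homPresheaf R P).obj X) A :=
  LinearEquiv.refl R (A.obj ⟶ X)

variable {R}

lemma res_secHom {X : C} {A B : P.FullSubcategory} (f : A ⟶ B) (a : B.obj ⟶ X) :
    res ((homPresheaf R P).obj X) f (secHom R a) = secHom R (f.hom ≫ a) := rfl

lemma evalAt_map_secHom {X Y : C} (k : X ⟶ Y) {A : P.FullSubcategory} (a : A.obj ⟶ X) :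
    evalAt ((homPresheaf R P).map k) A (secHom R a) = secHom R (a ≫ k) := rfl

lemma hom_ext_secHom {X : C} {F : LinearPresheaf R P.FullSubcategory}
    {φ ψ : (homPresheaf R P).obj X ⟶ F}
    (h : ∀ (A : P.FullSubcategory) (a : A.obj ⟶ X),
      evalAt φ A (secHom R a) = evalAt ψ A (secHom R a)) : φ = ψ :=
  hom_ext_evalAt h

lemma evalAt_secHom_comp {X : C} {F : LinearPresheaf R P.FullSubcategory}
    (φ : (homPresheaf R P).obj X ⟶ F) {A B : P.FullSubcategory} (f : A.obj ⟶ B.obj)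
    (a : B.obj ⟶ X) :
    evalAt φ A (secHom R (f ≫ a)) = res F (ObjectProperty.homMk f) (evalAt φ B (secHom R a)) :=
  evalAt_res φ (ObjectProperty.homMk f) (secHom R a)

end HomPresheaf

/-! ### Presentations of presheaves, and full faithfulness of X ↦ C(K-, X) -/

section Presentation

variable {R : Type w} [CommRing R] {C : Type u} [Category.{v} C] [Abelian C] [Linear R C]
  {P : ObjectProperty C}

-- Faithfulness is exactly what the generator hypothesis provides.
variable (R) in
lemma homPresheaf_map_injective (hP : P.IsSeparating) {X Y : C} {k l : X ⟶ Y}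
    (h : (homPresheaf R P).map k = (homPresheaf R P).map l) : k = l := by
  refine hP _ _ fun A hA a => (secHom R (P := P) (A := ⟨A, hA⟩)).injective ?_
  rw [← evalAt_map_secHom, ← evalAt_map_secHom, h]

/-- A presentation of a linear presheaf `F`: an exact sequence
`C(K-, B) ⟶ C(K-, G) ⟶ F ⟶ 0`. -/
structure HomPresentation (F : LinearPresheaf R P.FullSubcategory) where
  /-- the object of relations -/
  B : C
  /-- the object of generators -/
  G : C
  /-- the morphism of relations -/
  ρ : B ⟶ G
  /-- the projection -/
  ε : (homPresheaf R P).obj G ⟶ F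
  surjective (A : P.FullSubcategory) : Function.Surjective (evalAt ε A)
  exact (A : P.FullSubcategory) (g : A.obj ⟶ G) :
    evalAt ε A (secHom R g) = 0 ↔ ∃ b : A.obj ⟶ B, b ≫ ρ = g

namespace HomPresentation

variable {F : LinearPresheaf R P.FullSubcategory} (p : HomPresentation F)

/-- The object of `C` presented in the same way as `F`. -/
def realization : C := cokernel p.ρ

/-- The projection to the realization. -/
def π : p.G ⟶ p.realization := cokernel.π p.ρ

instance : Epi p.π := inferInstanceAs (Epi (cokernel.π p.ρ))

lemma ρ_π : p.ρ ≫ p.π = 0 := cokernel.condition p.ρ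

lemma exact_ρ_π : (ShortComplex.mk p.ρ p.π p.ρ_π).Exact :=
  ShortComplex.exact_of_g_is_cokernel _ (cokernelIsCokernel p.ρ)

/-- The two morphisms differ by a relation, which `π` kills. This makes `unit` independent of the
chosen lifts, hence linear and natural. -/
lemma comp_π_eq_of_evalAt_eq {A : P.FullSubcategory} {g g' : A.obj ⟶ p.G}
    (h : evalAt p.ε A (secHom R g) = evalAt p.ε A (secHom R g')) : g ≫ p.π = g' ≫ p.π := by
  rw [← sub_eq_zero, ← map_sub, ← map_sub, p.exact] at h
  obtain ⟨b, hb⟩ := h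
  rw [← sub_eq_zero, ← Preadditive.sub_comp, ← hb, Category.assoc, ρ_π, comp_zero]

/-- A lift of a section to a morphism to the object of generators. -/
def lift {A : P.FullSubcategory} (x : sec F A) : A.obj ⟶ p.G :=
  (secHom R).symm (p.surjective A x).choose

lemma evalAt_lift {A : P.FullSubcategory} (x : sec F A) :
    evalAt p.ε A (secHom R (p.lift x)) = x := by
  rw [lift, LinearEquiv.apply_symm_apply]
  exact (p.surjective A x).choose_spec

/-- The canonical morphism from a presheaf to the one represented by its realization. -/
def unit : F ⟶ (homPresheaf R P).obj p.realization :=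
  mkHom (fun A =>
    { toFun := fun x => secHom R (p.lift x ≫ p.π)
      map_add' := fun x y => by
        rw [← map_add, ← Preadditive.add_comp]
        exact congrArg _ (p.comp_π_eq_of_evalAt_eq (by simp only [map_add, evalAt_lift]))
      map_smul' := fun r x => by
        rw [RingHom.id_apply, ← map_smul, ← Linear.smul_comp]
        exact congrArg _ (p.comp_π_eq_of_evalAt_eq (by simp only [map_smul, evalAt_lift])) })
    fun A B f x => by
      change secHom R (p.lift (res F f x) ≫ p.π) = secHom R (f.hom ≫ p.lift x ≫ p.π)
      rw [← Category.assoc]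
      refine congrArg _ (p.comp_π_eq_of_evalAt_eq ?_)
      rw [evalAt_lift, ← res_secHom, evalAt_res, evalAt_lift]

lemma evalAt_unit {A : P.FullSubcategory} (g : A.obj ⟶ p.G) :
    evalAt p.unit A (evalAt p.ε A (secHom R g)) = secHom R (g ≫ p.π) :=
  congrArg (secHom R) (p.comp_π_eq_of_evalAt_eq (p.evalAt_lift _))

end HomPresentation

variable [HasColimitsOfSize.{v, v} C]

/-- Morphisms out of `C(K-, ∐ Aᵢ)` are determined by their values on the coproduct inclusions. -/
lemma hom_ext_coproduct (hfp : ∀ X : C, P X → IsFinitelyPresentable.{v} X)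
    {I : Type v} {A : I → P.FullSubcategory} {F : LinearPresheaf R P.FullSubcategory}
    {φ ψ : (homPresheaf R P).obj (∐ fun i => (A i).obj) ⟶ F}
    (h : ∀ i, evalAt φ (A i) (secHom R (Sigma.ι (fun i => (A i).obj) i)) =
      evalAt ψ (A i) (secHom R (Sigma.ι (fun i => (A i).obj) i))) : φ = ψ := by
  refine hom_ext_secHom fun B b => ?_
  have := hfp _ B.property
  obtain ⟨s, t, rfl⟩ := exists_eq_sum_ι _ b
  simp only [map_sum, evalAt_secHom_comp, h]

/-- Since the objects of `P` are finitely presentable, `C(K-, ∐ Aᵢ)` is the coproduct of the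
representable presheaves given by the `Aᵢ`. -/
lemma exists_hom_coproduct (hfp : ∀ X : C, P X → IsFinitelyPresentable.{v} X)
    {I : Type v} (A : I → P.FullSubcategory) (F : LinearPresheaf R P.FullSubcategory)
    (x : ∀ i, sec F (A i)) :
    ∃ φ : (homPresheaf R P).obj (∐ fun i => (A i).obj) ⟶ F,
      ∀ i, evalAt φ (A i) (secHom R (Sigma.ι (fun i => (A i).obj) i)) = x i := by
  classical
  let f (i : I) : C := (A i).obj
  -- The contribution of the `i`-th coordinate of `b`. Only finitely many are nonzero, since `b` is
  -- a finite sum through the summands; the `finsum` below would otherwise take its default value.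
  let term {B : P.FullSubcategory} (b : B.obj ⟶ ∐ f) (i : I) : sec F B :=
    res F (ObjectProperty.homMk (b ≫ Sigma.π f i)) (x i)
  have hterm {B : P.FullSubcategory} (b : B.obj ⟶ ∐ f) : (term b).support.Finite := by
    have := hfp _ B.property
    obtain ⟨s, t, rfl⟩ := exists_eq_sum_ι f b
    refine s.finite_toSet.subset fun i hi => ?_
    by_contra his
    refine hi ?_
    have : (∑ j ∈ s, t j ≫ Sigma.ι f j) ≫ Sigma.π f i = 0 := by
      rw [Preadditive.sum_comp]
      refine Finset.sum_eq_zero fun j hj => ?_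
      rw [Category.assoc, Sigma.ι_π_of_ne, comp_zero]
      rintro rfl
      exact his hj
    change res F (ObjectProperty.homMk _) (x i) = 0
    rw [this]
    exact res_zero F (x i)
  have hadd {B : P.FullSubcategory} (b c : B.obj ⟶ ∐ f) (i : I) :
      term (b + c) i = term b i + term c i := by
    rw [← res_add]
    exact congrArg (fun g => res F (ObjectProperty.homMk g) (x i)) (Preadditive.add_comp _ _ _ b c _)
  have hsmul {B : P.FullSubcategory} (r : R) (b : B.obj ⟶ ∐ f) (i : I) :
      term (r • b) i = r • term b i := by
    rw [← res_smul]
    exact congrArg (fun g => res F (ObjectProperty.homMk g) (x i)) (Linear.smul_comp _ _ _ r b _)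
  let val (B : P.FullSubcategory) : (B.obj ⟶ ∐ f) →ₗ[R] sec F B :=
    { toFun := fun b => ∑ᶠ i, term b i
      map_add' := fun b c => by
        rw [← finsum_add_distrib (hterm b) (hterm c)]
        exact finsum_congr (hadd b c)
      map_smul' := fun r b => by
        rw [RingHom.id_apply, smul_finsum' r (hterm b)]
        exact finsum_congr (hsmul r b) }
  refine ⟨mkHom (fun B => val B ∘ₗ (secHom R).symm.toLinearMap) fun B D g b => ?_, fun i => ?_⟩
  · obtain ⟨b, rfl⟩ := (secHom R).surjective b
    change ∑ᶠ i, term (g.hom ≫ b) i = res F g (∑ᶠ i, term b i)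
    refine Eq.trans (finsum_congr fun i => ?_) ((res F g).toAddMonoidHom.map_finsum (hterm b)).symm
    refine Eq.trans ?_ (res_comp F g _ (x i))
    exact congrArg (fun g => res F (ObjectProperty.homMk g) (x i)) (Category.assoc _ _ _)
  · change ∑ᶠ j, term (Sigma.ι f i) j = x i
    rw [finsum_eq_single _ i fun j hj => ?_]
    · dsimp only [term]
      rw [Sigma.ι_π_eq_id]
      exact res_id F (x i)
    · dsimp only [term]
      rw [Sigma.ι_π_of_ne _ hj.symm]
      exact res_zero F (x j)

/-- Every morphism between presheaves `C(K-, X)` comes from a morphism in `C`. -/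
lemma homPresheaf_map_surjective (M : SmallModel P) (hP : P.IsSeparating)
    (hfp : ∀ X : C, P X → IsFinitelyPresentable.{v} X) {X Y : C}
    (φ : (homPresheaf R P).obj X ⟶ (homPresheaf R P).obj Y) :
    ∃ k : X ⟶ Y, (homPresheaf R P).map k = φ := by
  let I := Σ j, (M.obj j ⟶ X)
  let A (i : I) : P.FullSubcategory := ⟨M.obj i.1, M.prop i.1⟩
  let p : (∐ fun i => (A i).obj) ⟶ X := Limits.Sigma.desc fun i : I => i.2
  have : Epi p := M.epi_desc hP X
  let q : (∐ fun i => (A i).obj) ⟶ Y :=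
    Limits.Sigma.desc fun i : I => (secHom R).symm (evalAt φ (A i) (secHom R i.2))
  have hq : (homPresheaf R P).map p ≫ φ = (homPresheaf R P).map q := by
    refine hom_ext_coproduct hfp fun i => ?_
    rw [evalAt_comp, evalAt_map_secHom, evalAt_map_secHom, Sigma.ι_desc, Sigma.ι_desc,
      LinearEquiv.apply_symm_apply]
  -- By faithfulness this may be checked on presheaves, where `q` factors through `p`.
  have hpq : kernel.ι p ≫ q = 0 := by
    refine homPresheaf_map_injective R hP ?_
    rw [Functor.map_comp, ← hq, ← Functor.map_comp_assoc, kernel.condition]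
    refine hom_ext_secHom fun B b => ?_
    rw [evalAt_comp, evalAt_map_secHom, evalAt_map_secHom, comp_zero, comp_zero, map_zero,
      map_zero, map_zero]
  have hex : (ShortComplex.mk (kernel.ι p) p (kernel.condition p)).Exact :=
    ShortComplex.exact_of_f_is_kernel _ (kernelIsKernel p)
  refine ⟨hex.desc q hpq, hom_ext_secHom fun B b => ?_⟩
  obtain ⟨j, ⟨e⟩⟩ := M.exists_iso B.property
  let i : I := ⟨j, e.inv ≫ b⟩
  -- Every section over `A` factors through the cover `p`, so `φ` is determined by `q`.
  have hb : b = (e.hom ≫ Sigma.ι (fun i => (A i).obj) i) ≫ p := by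
    rw [Category.assoc, Sigma.ι_desc, Iso.hom_inv_id_assoc]
  rw [hb, evalAt_map_secHom, Category.assoc, hex.g_desc q hpq, ← evalAt_map_secHom, ← hq,
    evalAt_comp, evalAt_map_secHom]

/-- All sections over the small model serve as generators; all morphisms from model objects to `G`
that `ε` kills serve as relations. -/
lemma nonempty_homPresentation (M : SmallModel P)
    (hfp : ∀ X : C, P X → IsFinitelyPresentable.{v} X)
    (F : LinearPresheaf R P.FullSubcategory) : Nonempty (HomPresentation F) := by
  let O (j : M.J) : P.FullSubcategory := ⟨M.obj j, M.prop j⟩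
  let I := Σ j, sec F (O j)
  obtain ⟨ε, hε⟩ := exists_hom_coproduct (R := R) hfp (fun i : I => O i.1) F fun i => i.2
  let I' := Σ j, { g : (O j).obj ⟶ ∐ (fun i : I => (O i.1).obj) //
    evalAt ε (O j) (secHom R g) = 0 }
  let ρ : (∐ fun i : I' => (O i.1).obj) ⟶ ∐ (fun i : I => (O i.1).obj) :=
    Limits.Sigma.desc fun i : I' => i.2.1
  refine ⟨⟨_, _, ρ, ε, fun A x => ?_, fun A g => ⟨fun hg => ?_, ?_⟩⟩⟩
  · obtain ⟨j, ⟨e⟩⟩ := M.exists_iso A.property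
    let a : A ⟶ O j := ObjectProperty.homMk e.hom
    let b : O j ⟶ A := ObjectProperty.homMk e.inv
    have hab : a ≫ b = 𝟙 A := ObjectProperty.hom_ext _ e.hom_inv_id
    refine ⟨secHom R (a.hom ≫ Sigma.ι (fun i : I => (O i.1).obj) ⟨j, res F b x⟩), ?_⟩
    rw [← res_secHom, evalAt_res, hε ⟨j, res F b x⟩, ← res_comp, hab, res_id]
  · obtain ⟨j, ⟨e⟩⟩ := M.exists_iso A.property
    let b : O j ⟶ A := ObjectProperty.homMk e.inv
    refine ⟨e.hom ≫ Sigma.ι (fun i : I' => (O i.1).obj) ⟨j, b.hom ≫ g, ?_⟩, ?_⟩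
    · rw [← res_secHom, evalAt_res, hg, map_zero]
    · rw [Category.assoc, Sigma.ι_desc]
      exact e.hom_inv_id_assoc g
  · rintro ⟨b, rfl⟩
    have h0 : (homPresheaf R P).map ρ ≫ ε = (homPresheaf R P).map 0 ≫ ε := by
      refine hom_ext_coproduct hfp fun i => ?_
      rw [evalAt_comp, evalAt_comp, evalAt_map_secHom, evalAt_map_secHom, Sigma.ι_desc, i.2.2,
        comp_zero, map_zero, map_zero]
    rw [← evalAt_map_secHom, ← evalAt_comp, h0, evalAt_comp, evalAt_map_secHom, comp_zero,
      map_zero, map_zero]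

namespace HomPresentation

variable {F : LinearPresheaf R P.FullSubcategory} (p : HomPresentation F)

/-- The realization corepresents morphisms to presheaves `C(K-, X)`. -/
lemma bijective_unit_comp (M : SmallModel P) (hP : P.IsSeparating)
    (hfp : ∀ X : C, P X → IsFinitelyPresentable.{v} X) (X : C) :
    Function.Bijective
      (fun h : p.realization ⟶ X => p.unit ≫ (homPresheaf R P).map h) := by
  refine ⟨fun h h' hh => ?_, fun φ => ?_⟩
  · refine (cancel_epi p.π).1 (homPresheaf_map_injective R hP (hom_ext_secHom fun A g => ?_))
    have := congrArg (fun φ => evalAt φ A (evalAt p.ε A (secHom R g))) hh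
    simpa only [evalAt_comp, evalAt_unit, evalAt_map_secHom, Category.assoc] using this
  · obtain ⟨k, hk⟩ := homPresheaf_map_surjective M hP hfp (p.ε ≫ φ)
    have hρ : p.ρ ≫ k = 0 := by
      refine homPresheaf_map_injective R hP (hom_ext_secHom fun A b => ?_)
      rw [Functor.map_comp, hk, evalAt_comp, evalAt_comp, evalAt_map_secHom,
        (p.exact A _).2 ⟨b, rfl⟩, evalAt_map_secHom, comp_zero, map_zero, map_zero]
    obtain ⟨h, rfl⟩ : ∃ h : p.realization ⟶ X, p.π ≫ h = k :=
      ⟨cokernel.desc p.ρ k hρ, cokernel.π_desc p.ρ k hρ⟩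
    refine ⟨h, hom_ext_evalAt fun A x => ?_⟩
    obtain ⟨g, rfl⟩ := p.surjective A x
    obtain ⟨g, rfl⟩ := (secHom R).surjective g
    rw [← evalAt_comp p.ε φ, ← hk, evalAt_comp, evalAt_unit, evalAt_map_secHom,
      evalAt_map_secHom, Category.assoc]

end HomPresentation

end Presentation

/-! ### Invertibility of the unit at left exact presheaves -/

section LexUnit

variable {R : Type w} [CommRing R] {C : Type u} [Category.{v} C] [Abelian C] [Linear R C]
  {P : ObjectProperty C} [HasColimitsOfSize.{v, v} C]

/-- Every epimorphism between objects of `P` is part of a right exact sequence in `P`. -/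
lemma exists_right_exact (M : SmallModel P) (hP : P.IsSeparating)
    (hfp : ∀ X : C, P X → IsFinitelyPresentable.{v} X)
    (hsum : ∀ (n : ℕ) (X : Fin n → C), (∀ i, P (X i)) →
      ∃ b : Bicone X, Nonempty b.IsBilimit ∧ P b.pt)
    {A B : P.FullSubcategory} (f : A ⟶ B) [Epi f.hom] :
    ∃ (D : P.FullSubcategory) (d : D ⟶ A) (w : d ≫ f = 0),
      ShortComplex.mk d f w ∈ rightExactSequences P := by
  have := hfp _ A.property
  have := hfp _ B.property
  obtain ⟨D, hD, d, w, h⟩ := exists_exact_of_exact M hP hsum (kernel.ι f.hom) f.hom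
    (kernel.condition f.hom) (ShortComplex.exact_of_f_is_kernel _ (kernelIsKernel f.hom))
  refine ⟨⟨D, hD⟩, ObjectProperty.homMk (d ≫ kernel.ι f.hom), ObjectProperty.hom_ext _ w, h, ?_⟩
  assumption

lemma res_injective_of_isLex (M : SmallModel P) (hP : P.IsSeparating)
    (hfp : ∀ X : C, P X → IsFinitelyPresentable.{v} X)
    (hsum : ∀ (n : ℕ) (X : Fin n → C), (∀ i, P (X i)) →
      ∃ b : Bicone X, Nonempty b.IsBilimit ∧ P b.pt)
    {F : LinearPresheaf R P.FullSubcategory} (hF : IsLex R (rightExactSequences P) F)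
    {A B : P.FullSubcategory} (f : A ⟶ B) [Epi f.hom] : Function.Injective (res F f) := by
  obtain ⟨D, d, w, h⟩ := exists_right_exact M hP hfp hsum f
  exact (hF _ h).1

namespace HomPresentation

variable {F : LinearPresheaf R P.FullSubcategory} (p : HomPresentation F)

/-- For a left exact presheaf `F`, the sections of `F` are the morphisms to the realization. -/
lemma isIso_unit (M : SmallModel P) (hP : P.IsSeparating)
    (hfp : ∀ X : C, P X → IsFinitelyPresentable.{v} X)
    (hsum : ∀ (n : ℕ) (X : Fin n → C), (∀ i, P (X i)) →
      ∃ b : Bicone X, Nonempty b.IsBilimit ∧ P b.pt)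
    (hF : IsLex R (rightExactSequences P) F) : IsIso p.unit := by
  have hinj (A : P.FullSubcategory) : Function.Injective (evalAt p.unit A) := by
    rw [injective_iff_map_eq_zero]
    intro x hx
    obtain ⟨g, rfl⟩ := p.surjective A x
    obtain ⟨g, rfl⟩ := (secHom R).surjective g
    rw [evalAt_unit, LinearEquiv.map_eq_zero_iff] at hx
    -- `g` becomes a relation after an epimorphism `e`; refined by an object of `P`, this shows that
    -- `x` vanishes on a cover, and restriction to the cover is injective.
    obtain ⟨E, e, he, b, hb⟩ := p.exact_ρ_π.exact_up_to_refinements g hx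
    obtain ⟨D, hD, d, hde⟩ := exists_epi_of_epi M hP hsum hfp A.property e
    let f : (⟨D, hD⟩ : P.FullSubcategory) ⟶ A := ObjectProperty.homMk (d ≫ e)
    have : Epi f.hom := hde
    refine res_injective_of_isLex M hP hfp hsum hF f ?_
    rw [map_zero, ← evalAt_res, res_secHom, p.exact]
    refine ⟨d ≫ b, ?_⟩
    change _ = (d ≫ e) ≫ g
    rw [Category.assoc, Category.assoc]
    exact congrArg (d ≫ ·) hb.symm
  refine isIso_of_bijective_evalAt _ fun A => ⟨hinj A, fun y => ?_⟩
  obtain ⟨y, rfl⟩ := (secHom R).surjective y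
  obtain ⟨E, e, he, g, hg⟩ := surjective_up_to_refinements_of_epi p.π y
  obtain ⟨B, hB, d, hde⟩ := exists_epi_of_epi M hP hsum hfp A.property e
  let f : (⟨B, hB⟩ : P.FullSubcategory) ⟶ A := ObjectProperty.homMk (d ≫ e)
  have : Epi f.hom := hde
  obtain ⟨D, k, w, h⟩ := exists_right_exact M hP hfp hsum f
  let x : sec F ⟨B, hB⟩ := evalAt p.ε ⟨B, hB⟩ (secHom R (d ≫ g))
  have hx : evalAt p.unit _ x = secHom R (f.hom ≫ y) := by
    rw [evalAt_unit, Category.assoc, ← hg, ← Category.assoc]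
    rfl
  -- Injectivity moves the question to `f ≫ y`, which `k` kills as `k ≫ f = 0`. Exactness of `F`
  -- then descends `x` along `f`.
  have hkx : res F k x = 0 := by
    refine hinj _ ?_
    rw [evalAt_res, hx, res_secHom, map_zero, ← Category.assoc,
      ← ObjectProperty.FullSubcategory.comp_hom, w]
    exact congrArg _ zero_comp
  obtain ⟨z, hz⟩ := ((hF _ h).2 x).1 hkx
  change res F f z = x at hz
  refine ⟨z, ?_⟩
  obtain ⟨z', hz'⟩ := (secHom R).surjective (evalAt p.unit A z)
  have h1 := evalAt_res p.unit f z
  rw [hz, hx, ← hz', res_secHom, EmbeddingLike.apply_eq_iff_eq, cancel_epi] at h1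
  rw [← hz', h1]

end HomPresentation

end LexUnit

/-! ### Left adjoints of X ↦ C(K-, X) as linear Kan extensions -/

section KanExtension

variable {R : Type w} [CommRing R] {C : Type u} [Category.{v} C] [Abelian C] [Linear R C]
  {P : ObjectProperty C} {L : LinearPresheaf R P.FullSubcategory ⥤ C}
  (adj : L ⊣ homPresheaf R P)

instance : (homPresheaf R P).Additive where
  map_add {X Y f g} := hom_ext_secHom fun A a => by
    change _ = evalAt ((homPresheaf R P).map f) A _ + evalAt ((homPresheaf R P).map g) A _
    simp only [evalAt_map_secHom, Preadditive.comp_add, map_add]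

instance : (homPresheaf R P).Linear R where
  map_smul {X Y} f r := hom_ext_secHom fun A a => by
    change _ = r • evalAt ((homPresheaf R P).map f) A _
    simp only [evalAt_map_secHom, Linear.comp_smul, map_smul]

include adj in
lemma linear_of_adjunction : L.Linear R where
  map_smul {X Y} f r := (adj.homEquiv _ _).injective (by
    rw [adj.homEquiv_unit, adj.homEquiv_unit, (homPresheaf R P).map_smul, Linear.comp_smul,
      adj.unit_naturality, adj.unit_naturality, Linear.smul_comp])

/-- The value of the unit of the adjunction on a section. -/
def unitSec {F : LinearPresheaf R P.FullSubcategory} {A : P.FullSubcategory} (x : sec F A) :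
    A.obj ⟶ L.obj F :=
  (secHom R).symm (evalAt (adj.unit.app F) A x)

lemma unitSec_res {F : LinearPresheaf R P.FullSubcategory} {A B : P.FullSubcategory}
    (f : A ⟶ B) (x : sec F B) : unitSec adj (res F f x) = f.hom ≫ unitSec adj x := by
  have := evalAt_res (adj.unit.app F) f x
  exact congrArg (secHom R).symm this

lemma unitSec_map {F G : LinearPresheaf R P.FullSubcategory} {A : P.FullSubcategory}
    (φ : F ⟶ G) (x : sec F A) : unitSec adj (evalAt φ A x) = unitSec adj x ≫ L.map φ := by
  have := congrArg (fun ψ => evalAt ψ A x) (adj.unit_naturality φ)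
  exact congrArg (secHom R).symm this.symm

lemma hom_ext_unitSec {F : LinearPresheaf R P.FullSubcategory} {X : C} {h k : L.obj F ⟶ X}
    (hk : ∀ (A : P.FullSubcategory) (x : sec F A), unitSec adj x ≫ h = unitSec adj x ≫ k) :
    h = k := by
  refine (adj.homEquiv _ _).injective (hom_ext_evalAt fun A x => ?_)
  rw [adj.homEquiv_unit, adj.homEquiv_unit]
  exact congrArg (secHom R) (hk A x)

lemma unitSec_homEquiv_symm {F : LinearPresheaf R P.FullSubcategory} {X : C}
    (φ : F ⟶ (homPresheaf R P).obj X) {A : P.FullSubcategory} (x : sec F A) :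
    unitSec adj x ≫ (adj.homEquiv _ _).symm φ = (secHom R).symm (evalAt φ A x) := by
  obtain ⟨h, rfl⟩ := (adj.homEquiv _ _).surjective φ
  rw [Equiv.symm_apply_apply, adj.homEquiv_unit]
  rfl

/-- The comparison of the inclusion with the restriction along the Yoneda embedding of a left
adjoint of `C(K-, -)`. -/
def yonedaUnit : P.ι ⟶ linYoneda R P.FullSubcategory ⋙ L where
  app A := unitSec adj (yonedaSec (𝟙 A))
  naturality A B f := by
    refine (unitSec_res adj f (yonedaSec (𝟙 B))).symm.trans ?_
    refine Eq.trans ?_ (unitSec_map adj ((linYoneda R P.FullSubcategory).map f) _)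
    rw [res_yonedaSec, evalAt_linYoneda_map, Category.comp_id, Category.id_comp]

/-- A section is the image of the universal one under its Yoneda map; hence transformations out of
`L` are determined on representables. -/
lemma unitSec_eq {F : LinearPresheaf R P.FullSubcategory} {A : P.FullSubcategory} (x : sec F A) :
    unitSec adj x = (yonedaUnit adj).app A ≫ L.map (yonedaMap x) := by
  refine Eq.trans ?_ (unitSec_map adj (yonedaMap x) _)
  rw [evalAt_yonedaMap, res_id]

/-- A left adjoint of `C(K-, -)` is a linear left Kan extension of the inclusion along the Yoneda
embedding. -/
lemma isLinearLeftKanExtension_yonedaUnit :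
    IsLinearLeftKanExtension R (linYoneda R P.FullSubcategory) P.ι L (yonedaUnit adj) where
  additive := adj.left_adjoint_additive
  linear := linear_of_adjunction adj
  bijective G _ _ := by
    refine ⟨fun β β' h => ?_, fun γ => ?_⟩
    · ext F
      refine hom_ext_unitSec adj fun A x => ?_
      have hA : (yonedaUnit adj).app A ≫ β.app _ = (yonedaUnit adj).app A ≫ β'.app _ :=
        congrArg (fun τ => τ.app A) h
      rw [unitSec_eq, Category.assoc, Category.assoc, β.naturality, β'.naturality,
        reassoc_of% hA]
    -- A section is a map from a representable; apply `G` to it and precompose with `γ`. Linearity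
    -- of `G` makes this linear in the section, and the transpose of `φ` is the required
    -- transformation.
    · let φ (F : LinearPresheaf R P.FullSubcategory) : F ⟶ (homPresheaf R P).obj (G.obj F) :=
        mkHom (fun A =>
          { toFun := fun x => secHom R (γ.app A ≫ G.map (yonedaMap x))
            map_add' := fun x y => by
              rw [yonedaMap_add, G.map_add, Preadditive.comp_add, map_add]
            map_smul' := fun r x => by
              rw [yonedaMap_smul, G.map_smul, Linear.comp_smul, map_smul, RingHom.id_apply] })
          fun A B f x => by
            have := γ.naturality f =≫ G.map (yonedaMap x)
            change secHom R (γ.app A ≫ G.map (yonedaMap (res F f x))) =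
              secHom R (f.hom ≫ γ.app B ≫ G.map (yonedaMap x))
            rw [← linYoneda_map_comp_yonedaMap, G.map_comp]
            rw [Category.assoc, Category.assoc] at this
            exact congrArg (secHom R) this.symm
      have hφ {F : LinearPresheaf R P.FullSubcategory} {A : P.FullSubcategory} (x : sec F A) :
          unitSec adj x ≫ (adj.homEquiv _ _).symm (φ F) = γ.app A ≫ G.map (yonedaMap x) :=
        unitSec_homEquiv_symm adj (φ F) x
      refine ⟨{ app := fun F => (adj.homEquiv _ _).symm (φ F), naturality := fun F F' f => ?_ }, ?_⟩
      · refine hom_ext_unitSec adj fun A x => ?_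
        rw [← Category.assoc, ← unitSec_map, hφ, ← Category.assoc, hφ, ← yonedaMap_comp,
          G.map_comp, Category.assoc]
      · ext A
        refine (hφ (yonedaSec (𝟙 A))).trans ?_
        have : yonedaMap (yonedaSec (𝟙 A)) = 𝟙 ((linYoneda R P.FullSubcategory).obj A) :=
          yoneda_hom_ext (by rw [evalAt_yonedaMap, res_id, evalAt_id])
        rw [this, G.map_id]
        exact Category.comp_id _

end KanExtension

/-! ### Uniqueness of linear Kan extensions -/

section Uniqueness

variable {R : Type w} [CommRing R]
  {A : Type u₁} [Category.{v₁} A]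
  {B : Type u₂} [Category.{v₂} B] [Preadditive B] [Linear R B]
  {D : Type u₃} [Category.{v₃} D] [Preadditive D] [Linear R D]

/-- Linear left Kan extensions are unique up to isomorphism. -/
lemma IsLinearLeftKanExtension.nonempty_iso {J : A ⥤ B} {F : A ⥤ D} {L L' : B ⥤ D}
    {α : F ⟶ J ⋙ L} {α' : F ⟶ J ⋙ L'} (h : IsLinearLeftKanExtension R J F L α)
    (h' : IsLinearLeftKanExtension R J F L' α') : Nonempty (L ≅ L') := by
  obtain ⟨β, hβ⟩ := (h.bijective L' h'.additive h'.linear).2 α'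
  obtain ⟨β', hβ'⟩ := (h'.bijective L h.additive h.linear).2 α
  dsimp only at hβ hβ'
  refine ⟨⟨β, β', (h.bijective L h.additive h.linear).1 ?_,
    (h'.bijective L' h'.additive h'.linear).1 ?_⟩⟩
  · dsimp only
    rw [Functor.whiskerLeft_comp, ← Category.assoc, hβ, hβ', Functor.whiskerLeft_id']
    exact (Category.comp_id α).symm
  · dsimp only
    rw [Functor.whiskerLeft_comp, ← Category.assoc, hβ', hβ, Functor.whiskerLeft_id']
    exact (Category.comp_id α').symm

end Uniqueness

/-! ### The adjunction and its restriction to Lex_Σ -/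

section Equivalence

variable {R : Type w} [CommRing R] {C : Type u} [Category.{v} C] [Abelian C] [Linear R C]
  {P : ObjectProperty C}

/-- The functor `X ↦ C(K-, X)` has a left adjoint, and the unit is invertible at left exact
presheaves. -/
lemma exists_adjunction [HasColimitsOfSize.{v, v} C] (M : SmallModel P) (hP : P.IsSeparating)
    (hfp : ∀ X : C, P X → IsFinitelyPresentable.{v} X)
    (hsum : ∀ (n : ℕ) (X : Fin n → C), (∀ i, P (X i)) →
      ∃ b : Bicone X, Nonempty b.IsBilimit ∧ P b.pt) :
    ∃ (L : LinearPresheaf R P.FullSubcategory ⥤ C) (adj : L ⊣ homPresheaf R P),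
      ∀ F, IsLex R (rightExactSequences P) F → IsIso (adj.unit.app F) := by
  let p (F : LinearPresheaf R P.FullSubcategory) : HomPresentation F :=
    (nonempty_homPresentation M hfp F).some
  let e (F : LinearPresheaf R P.FullSubcategory) (X : C) :
      ((p F).realization ⟶ X) ≃ (F ⟶ (homPresheaf R P).obj X) :=
    Equiv.ofBijective _ ((p F).bijective_unit_comp M hP hfp X)
  have he (F : LinearPresheaf R P.FullSubcategory) (X Y : C) (g : X ⟶ Y)
      (h : (p F).realization ⟶ X) : e F Y (h ≫ g) = e F X h ≫ (homPresheaf R P).map g := by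
    simp [e]
  let adj := Adjunction.adjunctionOfEquivLeft e he
  refine ⟨_, adj, fun F hF => ?_⟩
  have hu : adj.unit.app F = (p F).unit := by
    refine (Adjunction.adjunctionOfEquivLeft_unit_app e he F).trans ?_
    change (p F).unit ≫ (homPresheaf R P).map (𝟙 _) = _
    rw [CategoryTheory.Functor.map_id, Category.comp_id]
  rw [hu]
  exact (p F).isIso_unit M hP hfp hsum hF

section

variable {L : LinearPresheaf R P.FullSubcategory ⥤ C} (adj : L ⊣ homPresheaf R P)

-- A fully faithful right adjoint has invertible counit, and `homLex` followed by the inclusion is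
-- `homPresheaf` by definition.
include adj in
lemma nonempty_homLex_comp_iso [(homPresheaf R P).Full] [(homPresheaf R P).Faithful] :
    Nonempty (homLex R P ⋙ ((IsLex R (rightExactSequences P)).ι ⋙ L) ≅ 𝟭 C) :=
  ⟨asIso (C := C ⥤ C) (X := homPresheaf R P ⋙ L) adj.counit⟩

include adj in
lemma nonempty_comp_homLex_iso
    (h : ∀ F, IsLex R (rightExactSequences P) F → IsIso (adj.unit.app F)) :
    Nonempty (((IsLex R (rightExactSequences P)).ι ⋙ L) ⋙ homLex R P ≅
      𝟭 (Lex R (rightExactSequences P))) := by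
  let i (F : Lex R (rightExactSequences P)) :
      F.obj ≅ (homPresheaf R P).obj (L.obj F.obj) :=
    @asIso _ _ _ _ (adj.unit.app F.obj) (h F.obj F.property)
  let i' (F : Lex R (rightExactSequences P)) :
      F ≅ (((IsLex R (rightExactSequences P)).ι ⋙ L) ⋙ homLex R P).obj F :=
    (IsLex R (rightExactSequences P)).isoMk (i F)
  refine ⟨(NatIso.ofComponents (F := 𝟭 _) i' fun {F G} φ => ObjectProperty.hom_ext _ ?_).symm⟩
  exact (adj.unit_naturality φ.hom).symm

end

end Equivalence

end

end LinearLex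

theorem mainTheorem9 {R : Type w} [CommRing R] {C : Type u} [Category.{v} C] [Abelian C]
    [Linear R C] [IsLocallyFinitelyPresentable.{v} C]
    (P : ObjectProperty C)
    (hfp : ∀ X : C, P X → IsFinitelyPresentable.{v} X)
    (hgen : P.IsSeparating)
    (hsum : ∀ (n : ℕ) (X : Fin n → C), (∀ i, P (X i)) →
      ∃ b : Bicone X, Nonempty b.IsBilimit ∧ P b.pt) :
    (∃ (L : LinearLex.LinearPresheaf R P.FullSubcategory ⥤ C)
        (α : P.ι ⟶ LinearLex.linYoneda R P.FullSubcategory ⋙ L),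
        LinearLex.IsLinearLeftKanExtension R
          (LinearLex.linYoneda R P.FullSubcategory) P.ι L α) ∧
    ∀ (L : LinearLex.LinearPresheaf R P.FullSubcategory ⥤ C)
      (α : P.ι ⟶ LinearLex.linYoneda R P.FullSubcategory ⋙ L),
      LinearLex.IsLinearLeftKanExtension R
        (LinearLex.linYoneda R P.FullSubcategory) P.ι L α →
      (LinearLex.homLex R P).IsEquivalence ∧
      ((LinearLex.IsLex R (LinearLex.rightExactSequences P)).ι ⋙ L).IsEquivalence ∧
      Nonempty (LinearLex.homLex R P ⋙
        ((LinearLex.IsLex R (LinearLex.rightExactSequences P)).ι ⋙ L) ≅ 𝟭 C) ∧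
      Nonempty (((LinearLex.IsLex R (LinearLex.rightExactSequences P)).ι ⋙ L) ⋙
        LinearLex.homLex R P ≅ 𝟭 (LinearLex.Lex R (LinearLex.rightExactSequences P))) := by
  have : HasColimitsOfSize.{v, v} C :=
    IsCardinalLocallyPresentable.toHasColimitsOfSize Cardinal.aleph0
  have : ObjectProperty.EssentiallySmall.{v} P :=
    .of_le (Q := ObjectProperty.isFinitelyPresentable.{v} C) hfp
  obtain ⟨M⟩ := LinearLex.nonempty_smallModel P
  obtain ⟨L₀, adj, hadj⟩ := LinearLex.exists_adjunction (R := R) M hgen hfp hsum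
  have hL₀ := LinearLex.isLinearLeftKanExtension_yonedaUnit adj
  refine ⟨⟨L₀, _, hL₀⟩, fun L α hL => ?_⟩
  have : (LinearLex.homPresheaf R P).Faithful :=
    ⟨LinearLex.homPresheaf_map_injective R hgen⟩
  have : (LinearLex.homPresheaf R P).Full :=
    ⟨LinearLex.homPresheaf_map_surjective M hgen hfp⟩
  -- An arbitrary Kan extension is isomorphic to the adjoint `L₀`, so the two isomorphisms transfer
  -- from `L₀` to `L`.
  obtain ⟨e⟩ := hL.nonempty_iso hL₀
  obtain ⟨i⟩ := LinearLex.nonempty_homLex_comp_iso adj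
  obtain ⟨j⟩ := LinearLex.nonempty_comp_homLex_iso adj hadj
  let e' := CategoryTheory.Functor.isoWhiskerLeft
    (LinearLex.IsLex R (LinearLex.rightExactSequences P)).ι e
  let i' := CategoryTheory.Functor.isoWhiskerLeft (LinearLex.homLex R P) e' ≪≫ i
  let j' := CategoryTheory.Functor.isoWhiskerRight e' (LinearLex.homLex R P) ≪≫ j
  exact ⟨(CategoryTheory.Equivalence.mk _ _ i'.symm j').isEquivalence_functor,
    (CategoryTheory.Equivalence.mk _ _ j'.symm i').isEquivalence_functor, ⟨i'⟩, ⟨j'⟩⟩
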